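/- Let $\mathbb{K}\in\{\mathbb{R},\mathbb{C}\}$, let $r>0$, let $X$ be a sequentially complete Hausdorff locally convex space over $\mathbb{K}$, and let $(T(t))_{t\ge 0}$ be a strongly continuous, locally equicontinuous semigroup of continuous linear operators on $X$. Here locally equicontinuous means that for every continuous seminorm $q$ on $X$ and every $t_0\ge 0$ there are a continuous seminorm $p$ on $X$ and $C\ge 0$ with $q(T(t)x)\le C\,p(x)$ for all $t\in[0,t_0]$ and $x\in X$. Let $(A,D(A))$ be the generator of $(T(t))_{t\ge 0}$, i.e. $D(A)=\{x\in X : \lim_{t\to 0+} t^{-1}(T(t)x-x)\text{ exists in }X\}$ and $Ax=\lim_{t\to 0+}t^{-1}(T(t)x-x)$ for $x\in D(A)$. Suppose that $(T(t))_{t\in[0,r]}$ is of bounded semivariation, i.e. for every continuous seminorm $q$ on $X$ there is a continuous seminorm $p$ on $X$ such that \[ \sup\Bigl\{ q\Bigl(\sum_{i=1}^{n}\bigl(T(d_i)-T(d_{i-1})\bigr)x_i\Bigr) : n\in\mathbb{N},\ 0=d_0<d_1<\dots<d_n=r,\ x_1,\dots,x_n\in X,\ p(x_i)\le 1 \text{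 for } 1\le i\le n\Bigr\}<\infty . \] Then $T(t)X\subset D(A)$ for all $t>0$, and for every $x\in X$ the map $[0,\infty)\to X$, $t\mapsto A\bigl(t\,T(t)x\bigr)$, is continuous (where $t\,T(t)x\in D(A)$ for all $t\ge 0$). -/

import Mathlib

open Filter Topology
open scoped NNReal ENNReal

/-- A uniform space is sequentially complete if every Cauchy sequence in it converges. -/
def IsSequentiallyComplete (X : Type*) [UniformSpace X] : Prop :=
  ∀ u : ℕ → X, CauchySeq u → ∃ x, Tendsto u atTop (𝓝 x)

section Semivariation

variable {𝕜 ι X Y : Type*} [RCLike 𝕜] [LinearOrder ι]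
  [AddCommGroup X] [Module 𝕜 X] [TopologicalSpace X]
  [AddCommGroup Y] [Module 𝕜 Y] [TopologicalSpace Y] [IsTopologicalAddGroup Y]

/-- `d 0 < d 1 < ⋯ < d n` is a partition of `[a, b]`. -/
structure IsIntervalPartition (a b : ι) {n : ℕ} (d : Fin (n + 1) → ι) : Prop where
  strictMono : StrictMono d
  left_eq : d 0 = a
  right_eq : d (Fin.last n) = b

/-- The supremum of `q (∑ i, (α (d i) - α (d (i - 1))) (x i))` over all families `x` with
`p (x i) ≤ 1` for all `i`, along a fixed finite sequence `d`. -/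
noncomputable def semivariationAlong (q : Seminorm 𝕜 Y) (p : Seminorm 𝕜 X)
    (α : ι → X →L[𝕜] Y) {n : ℕ} (d : Fin (n + 1) → ι) : ℝ≥0∞ :=
  ⨆ (x : Fin n → X) (_ : ∀ i, p (x i) ≤ 1),
    ENNReal.ofReal (q (∑ i : Fin n, (α (d i.succ) - α (d i.castSucc)) (x i)))

/-- The semivariation of `α` on `[a, b]` with respect to the seminorms `q` and `p`: the supremum
over all partitions of `[a, b]`. -/
noncomputable def semivariation (q : Seminorm 𝕜 Y) (p : Seminorm 𝕜 X)
    (α : ι → X →L[𝕜] Y) (a b : ι) : ℝ≥0∞ :=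
  ⨆ (n : ℕ) (d : Fin (n + 1) → ι) (_ : IsIntervalPartition a b d), semivariationAlong q p α d

/-- `α` is of bounded semivariation on `[a, b]`: for every continuous seminorm `q` on `Y` there is
a continuous seminorm `p` on `X` such that the semivariation of `α` with respect to `q` and `p` is
finite. The fundamental systems of seminorms used here are those of all continuous seminorms; the
notion does not depend on their choice. -/
def HasBoundedSemivariation (α : ι → X →L[𝕜] Y) (a b : ι) : Prop :=
  ∀ q : Seminorm 𝕜 Y, Continuous q →
    ∃ p : Seminorm 𝕜 X, Continuous p ∧ semivariation q p α a b < ∞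

end Semivariation

namespace OperatorFamily

section

variable {𝕜 X : Type*} [RCLike 𝕜] [AddCommGroup X] [Module 𝕜 X] [TopologicalSpace X]

/-- The semigroup law for a family of operators indexed by `[0, ∞)`. -/
structure IsSemigroup (T : ℝ≥0 → X →L[𝕜] X) : Prop where
  map_zero : T 0 = ContinuousLinearMap.id 𝕜 X
  map_add : ∀ t s : ℝ≥0, T (t + s) = (T t).comp (T s)

/-- All orbits are continuous on `[0, ∞)`. -/
def IsStronglyContinuous (T : ℝ≥0 → X →L[𝕜] X) : Prop :=
  ∀ x : X, Continuous fun t : ℝ≥0 => T t x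

/-- Local equicontinuity, with the fundamental system of all continuous seminorms. -/
def IsLocallyEquicontinuous (T : ℝ≥0 → X →L[𝕜] X) : Prop :=
  ∀ q : Seminorm 𝕜 X, Continuous q → ∀ t₀ : ℝ≥0,
    ∃ p : Seminorm 𝕜 X, Continuous p ∧ ∃ C : ℝ, 0 ≤ C ∧
      ∀ t : ℝ≥0, t ≤ t₀ → ∀ x : X, q (T t x) ≤ C * p x

/-- The difference quotients `(T(t)x - x) / t` converge to `y` as `t → 0+`. -/
def HasGeneratorValue (T : ℝ≥0 → X →L[𝕜] X) (x y : X) : Prop :=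
  Tendsto (fun t : ℝ≥0 => (((t : ℝ) : 𝕜))⁻¹ • (T t x - x)) (𝓝[>] 0) (𝓝 y)

end

section Generator

set_option linter.unusedSectionVars false

variable {𝕜 X : Type*} [RCLike 𝕜] [AddCommGroup X] [Module 𝕜 X] [TopologicalSpace X]
  [IsTopologicalAddGroup X] [ContinuousSMul 𝕜 X]

theorem HasGeneratorValue.add {T : ℝ≥0 → X →L[𝕜] X} {x y x' y' : X}
    (h : HasGeneratorValue T x y) (h' : HasGeneratorValue T x' y') :
    HasGeneratorValue T (x + x') (y + y') := by
  refine (Tendsto.add h h').congr fun t => ?_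
  rw [← smul_add, map_add]
  congr 1
  abel

theorem HasGeneratorValue.smul {T : ℝ≥0 → X →L[𝕜] X} {x y : X} (c : 𝕜)
    (h : HasGeneratorValue T x y) : HasGeneratorValue T (c • x) (c • y) := by
  refine (Tendsto.const_smul h c).congr fun t => ?_
  rw [smul_comm, smul_sub, map_smul]

theorem HasGeneratorValue.zero (T : ℝ≥0 → X →L[𝕜] X) : HasGeneratorValue T 0 0 := by
  simpa [HasGeneratorValue] using tendsto_const_nhds

theorem HasGeneratorValue.unique [T2Space X] {T : ℝ≥0 → X →L[𝕜] X} {x y y' : X}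
    (h : HasGeneratorValue T x y) (h' : HasGeneratorValue T x y') : y = y' :=
  tendsto_nhds_unique h h'

/-- The domain `D(A)`: all `x` for which the limit of `(T(t)x - x) / t` as `t → 0+` exists. -/
def generatorDomain (T : ℝ≥0 → X →L[𝕜] X) : Submodule 𝕜 X where
  carrier := {x | ∃ y, HasGeneratorValue T x y}
  add_mem' := fun ⟨y, hy⟩ ⟨y', hy'⟩ => ⟨y + y', hy.add hy'⟩
  zero_mem' := ⟨0, HasGeneratorValue.zero T⟩
  smul_mem' := fun c _ ⟨y, hy⟩ => ⟨c • y, hy.smul c⟩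

/-- The generator `(A, D(A))`, as a partially defined linear map: `A x` is the limit of
`(T(t)x - x) / t` as `t → 0+`. -/
noncomputable def generator [T2Space X] (T : ℝ≥0 → X →L[𝕜] X) : X →ₗ.[𝕜] X where
  domain := generatorDomain T
  toFun :=
    { toFun := fun x => x.2.choose
      map_add' := fun x x' =>
        (x + x').2.choose_spec.unique (x.2.choose_spec.add x'.2.choose_spec)
      map_smul' := fun c x => (c • x).2.choose_spec.unique (x.2.choose_spec.smul c) }

end Generator

end OperatorFamily

/-! On the grid `0, h, 2h, …` test the semivariation with the vectors `T (t - i * h) y`. By the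
semigroup law every summand equals `T (t + h) y - T t y`, and there are about `t / h` of them, so `t
* q (T (t + h) y - T t y)` is `O(h)`, with a constant proportional to the size of the orbit of `y`
(`exists_increment_bound`).

Apply this to `y = T (j * k) x - x`, which is small for small `j * k`, and telescope: difference
quotients at `t` with steps `k` and `m * k` differ by at most `ε / t`
(`exists_orbitQuotient_sub_le`). Common refinements make the quotients with steps `1 / (n + 1)`
Cauchy; density of the rationals and continuity in the step then give the limit along all steps.
Hence `T t x` lies in the domain for `0 < t < r`, and the semigroup carries this to all `t > 0`. The
weight `t` in the estimates makes them uniform in `t`, which yields continuity at `0`. -/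

/-! ### Semivariation bounds and grid partitions -/

theorem HasBoundedSemivariation.exists_le {𝕜 ι X Y : Type*} [RCLike 𝕜] [LinearOrder ι]
    [AddCommGroup X] [Module 𝕜 X] [TopologicalSpace X]
    [AddCommGroup Y] [Module 𝕜 Y] [TopologicalSpace Y] [IsTopologicalAddGroup Y]
    {α : ι → X →L[𝕜] Y} {a b : ι} (hα : HasBoundedSemivariation α a b)
    {q : Seminorm 𝕜 Y} (hq : Continuous q) :
    ∃ p : Seminorm 𝕜 X, Continuous p ∧ ∃ V : ℝ, 0 ≤ V ∧
      ∀ (n : ℕ) (d : Fin (n + 1) → ι), IsIntervalPartition a b d →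
        ∀ (K : ℝ) (x : Fin n → X), 0 < K → (∀ i, p (x i) ≤ K) →
          q (∑ i : Fin n, (α (d i.succ) - α (d i.castSucc)) (x i)) ≤ V * K := by
  obtain ⟨p, hp, hfin⟩ := hα q hq
  refine ⟨p, hp, (semivariation q p α a b).toReal, ENNReal.toReal_nonneg, ?_⟩
  intro n d hd K x hK hx
  have hnorm : ‖((K⁻¹ : ℝ) : 𝕜)‖ = K⁻¹ := by
    rw [RCLike.norm_ofReal, abs_of_pos (inv_pos.2 hK)]
  have hle : ENNReal.ofReal (q (∑ i : Fin n,
      (α (d i.succ) - α (d i.castSucc)) (((K⁻¹ : ℝ) : 𝕜) • x i))) ≤ semivariation q p α a b := by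
    refine le_trans ?_ (le_iSup_of_le n (le_iSup_of_le d (le_iSup_of_le hd le_rfl)))
    refine le_iSup₂_of_le (f := fun (x : Fin n → X) (_ : ∀ i, p (x i) ≤ 1) =>
      ENNReal.ofReal (q (∑ i : Fin n, (α (d i.succ) - α (d i.castSucc)) (x i))))
      (fun i => ((K⁻¹ : ℝ) : 𝕜) • x i) (fun i => ?_) le_rfl
    rw [map_smul_eq_mul, hnorm, inv_mul_le_iff₀ hK]
    simpa using hx i
  simp_rw [map_smul] at hle
  rw [← Finset.smul_sum, map_smul_eq_mul, hnorm, ENNReal.ofReal_le_iff_le_toReal hfin.ne,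
    inv_mul_le_iff₀ hK, mul_comm] at hle
  exact hle

/-- An equidistant grid need not end at `r`; the extra interval from `n * h` to `r` will carry the
test vector `0`. -/
theorem isIntervalPartition_snoc {h r : ℝ≥0} {n : ℕ} (hh : 0 < h) (hn : n * h < r) :
    IsIntervalPartition 0 r
      (Fin.snoc (α := fun _ => ℝ≥0) (fun i : Fin (n + 1) => (i : ℝ≥0) * h) r) where
  strictMono := by
    rw [Fin.strictMono_iff_lt_succ]
    intro i
    induction i using Fin.lastCases with
    | last => simpa using hn
    | cast i =>
      rw [Fin.succ_castSucc, Fin.snoc_castSucc, Fin.snoc_castSucc]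
      simp only [Fin.val_castSucc, Fin.val_succ, Nat.cast_add, Nat.cast_one]
      gcongr
      exact lt_add_one _
  left_eq := by
    rw [← Fin.castSucc_zero, Fin.snoc_castSucc]
    simp
  right_eq := by simp

theorem Seminorm.map_nnreal_inv_smul {𝕜 X : Type*} [RCLike 𝕜] [AddCommGroup X] [Module 𝕜 X]
    (q : Seminorm 𝕜 X) (h : ℝ≥0) (x : X) :
    q ((((h : ℝ) : 𝕜))⁻¹ • x) = (h : ℝ)⁻¹ * q x := by
  rw [map_smul_eq_mul, norm_inv, RCLike.norm_ofReal, abs_of_nonneg h.coe_nonneg]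

/-! ### Increments and difference quotients of orbits -/

namespace OperatorFamily

section

variable {𝕜 X : Type*} [RCLike 𝕜] [AddCommGroup X] [Module 𝕜 X] [TopologicalSpace X]
  {T : ℝ≥0 → X →L[𝕜] X}

theorem IsSemigroup.map_add_apply (hT : IsSemigroup T) (t s : ℝ≥0) (x : X) :
    T (t + s) x = T t (T s x) := by
  rw [hT.map_add]; rfl

theorem IsSemigroup.map_zero_apply (hT : IsSemigroup T) (x : X) : T 0 x = x := by
  rw [hT.map_zero]; rfl

/-- The difference quotient of the orbit of `x` at time `t` with step `h`. -/
noncomputable def orbitQuotient (T : ℝ≥0 → X →L[𝕜] X) (x : X) (t h : ℝ≥0) : X :=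
  (((h : ℝ) : 𝕜))⁻¹ • (T (t + h) x - T t x)

/-- The test vectors align all increments, so that one increment is counted `⌊t / h⌋` times within a
bounded sum. -/
theorem exists_increment_bound [IsTopologicalAddGroup X] (hT : IsSemigroup T) {r : ℝ≥0}
    (hbdd : HasBoundedSemivariation T 0 r) {q : Seminorm 𝕜 X} (hq : Continuous q) :
    ∃ p : Seminorm 𝕜 X, Continuous p ∧ ∃ V : ℝ, 0 ≤ V ∧
      ∀ (h t : ℝ≥0) (y : X) (K : ℝ), 0 < h → h ≤ t → t < r → 0 < K →
        (∀ s ≤ r, p (T s y) ≤ K) → t * q (T (t + h) y - T t y) ≤ 2 * (V * K) * h := by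
  obtain ⟨p, hp, V, hV, H⟩ := hbdd.exists_le hq
  refine ⟨p, hp, V, hV, fun h t y K hh hht htr hK hy => ?_⟩
  set n := ⌊t / h⌋₊ with hn
  have hnt : (n : ℝ≥0) * h ≤ t := by
    rw [← le_div_iff₀ hh]; exact Nat.floor_le (zero_le)
  have hn1 : 1 ≤ n := by
    rw [hn, Nat.one_le_floor_iff, one_le_div₀ hh]; exact hht
  have htn : t ≤ (n + 1) * h := by
    rw [← div_le_iff₀ hh]; exact (Nat.lt_floor_add_one _).le
  have key := H (n + 1) _ (isIntervalPartition_snoc hh (hnt.trans_lt htr)) K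
    (Fin.snoc (α := fun _ => X) (fun i : Fin n => T (t - i * h) y) 0) hK (fun i => by
      induction i using Fin.lastCases with
      | last => simpa using hK.le
      | cast i =>
        rw [Fin.snoc_castSucc]
        exact hy _ (tsub_le_self.trans htr.le))
  have hsum : ∀ i : Fin n, (T (((i : ℕ) + 1 : ℕ) * h) - T ((i : ℕ) * h)) (T (t - i * h) y) =
      T (t + h) y - T t y := by
    intro i
    have hi : (i : ℝ≥0) * h ≤ t := le_trans (by gcongr; exact i.2.le) hnt
    rw [sub_apply, ← hT.map_add_apply, ← hT.map_add_apply,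
      add_tsub_cancel_of_le hi]
    congr 3
    push_cast
    rw [add_mul, one_mul, add_right_comm, add_tsub_cancel_of_le hi]
  rw [Fin.sum_univ_castSucc] at key
  simp only [Fin.succ_castSucc, Fin.snoc_castSucc, Fin.snoc_last, map_zero, add_zero, Fin.val_succ,
    Fin.val_castSucc, hsum, Finset.sum_const, Finset.card_univ, Fintype.card_fin] at key
  rw [← Nat.cast_smul_eq_nsmul 𝕜, map_smul_eq_mul, RCLike.norm_natCast] at key
  -- Since `n ≥ 1`, `n + 1 ≤ 2 * n`; this is the source of the factor 2.
  have h1 : (t : ℝ) ≤ 2 * n * h := by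
    have h2 : (t : ℝ) ≤ (n + 1) * h := by exact_mod_cast htn
    have h3 : (1 : ℝ) ≤ n := by exact_mod_cast hn1
    nlinarith [h.coe_nonneg]
  calc (t : ℝ) * q (T (t + h) y - T t y)
      ≤ 2 * n * h * q (T (t + h) y - T t y) := by gcongr
    _ = 2 * (n * q (T (t + h) y - T t y)) * h := by ring
    _ ≤ 2 * (V * K) * h := by gcongr

/-- The error between the two quotients is an average of increments of the small vectors `T (j * k)
x - x`. The threshold `δ` does not depend on `t`. -/
theorem exists_orbitQuotient_sub_le [IsTopologicalAddGroup X] (hT : IsSemigroup T)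
    (hcont : IsStronglyContinuous T) (hequi : IsLocallyEquicontinuous T) {r : ℝ≥0}
    (hbdd : HasBoundedSemivariation T 0 r) {q : Seminorm 𝕜 X} (hq : Continuous q) (x : X)
    {ε : ℝ} (hε : 0 < ε) :
    ∃ δ : ℝ≥0, 0 < δ ∧ ∀ (t k : ℝ≥0) (m : ℕ), t < r → 0 < k → 0 < m → m * k ≤ t → m * k < δ →
      t * q (orbitQuotient T x t (m * k) - orbitQuotient T x t k) ≤ ε := by
  obtain ⟨p, hp, V, hV, H⟩ := exists_increment_bound hT hbdd hq
  obtain ⟨p', hp', C, hC, HC⟩ := hequi p hp r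
  -- Chosen so that `2 * (V * K) ≤ ε`; the `+ 1` covers `V = 0`.
  set K := ε / (2 * (V + 1)) with hKdef
  have hK : 0 < K := by positivity
  have hVK : 2 * (V * K) ≤ ε := by
    rw [hKdef]; field_simp; linarith
  have hlim : Tendsto (fun u : ℝ≥0 => C * p' (T u x - x)) (𝓝 0) (𝓝 0) := by
    have : Continuous fun u : ℝ≥0 => C * p' (T u x - x) :=
      continuous_const.mul (hp'.comp ((hcont x).sub continuous_const))
    simpa [hT.map_zero_apply] using this.tendsto 0
  obtain ⟨δ, hδ, hδK⟩ := (NNReal.nhds_zero_basis.mem_iff).1 (hlim.eventually_le_const hK)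
  refine ⟨δ, hδ, fun t k m htr hk hm hmt hmδ => ?_⟩
  have hm' : (1 : ℝ≥0) ≤ m := by exact_mod_cast hm
  have hkt : k ≤ t := le_trans (le_mul_of_one_le_left (zero_le) hm') hmt
  have hterm : ∀ j ∈ Finset.range m, t * q (T (t + k) (T (j * k) x - x) - T t (T (j * k) x - x))
      ≤ ε * k := by
    intro j hj
    refine (H k t _ K hk hkt htr hK fun s hs => (HC s hs _).trans ?_).trans (by gcongr)
    refine hδK (a := j * k) (lt_of_le_of_lt ?_ hmδ)
    gcongr
    exact (Finset.mem_range.1 hj).le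
  have hsum : T (t + m * k) x - T t x - (m : 𝕜) • (T (t + k) x - T t x) =
      ∑ j ∈ Finset.range m, (T (t + k) (T (j * k) x - x) - T t (T (j * k) x - x)) := by
    have h1 := Finset.sum_range_sub (fun j : ℕ => T (t + j * k) x) m
    simp only [Nat.cast_zero, zero_mul, add_zero] at h1
    rw [← h1, Nat.cast_smul_eq_nsmul, ← Finset.card_range m, ← Finset.sum_const,
      Finset.card_range, ← Finset.sum_sub_distrib]
    refine Finset.sum_congr rfl fun j _ => ?_
    rw [map_sub, map_sub, ← hT.map_add_apply, ← hT.map_add_apply]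
    have : t + ((j + 1 : ℕ) : ℝ≥0) * k = t + k + j * k := by push_cast; ring
    rw [this]; abel
  have hquot : orbitQuotient T x t (m * k) - orbitQuotient T x t k =
      ((((m * k : ℝ≥0) : ℝ) : 𝕜))⁻¹ •
        (T (t + m * k) x - T t x - (m : 𝕜) • (T (t + k) x - T t x)) := by
    have hm0 : (m : 𝕜) ≠ 0 := by exact_mod_cast hm.ne'
    rw [orbitQuotient, orbitQuotient, smul_sub _ (T (t + m * k) x - T t x), smul_smul]
    congr 2
    push_cast
    rw [mul_inv, mul_right_comm, inv_mul_cancel₀ hm0, one_mul]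
  have hmk : (0 : ℝ) < (m * k : ℝ≥0) := by
    exact_mod_cast mul_pos (by exact_mod_cast hm) hk
  rw [hquot, hsum, q.map_nnreal_inv_smul, mul_left_comm, inv_mul_le_iff₀ hmk]
  calc (t : ℝ) * q (∑ j ∈ Finset.range m, (T (t + k) (T (j * k) x - x) - T t (T (j * k) x - x)))
      ≤ t * ∑ j ∈ Finset.range m, q (T (t + k) (T (j * k) x - x) - T t (T (j * k) x - x)) := by
        gcongr
        exact Finset.le_sum_of_subadditive q (map_zero q).le (map_add_le_add q) _ _
    _ = ∑ j ∈ Finset.range m, t * q (T (t + k) (T (j * k) x - x) - T t (T (j * k) x - x)) :=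
        Finset.mul_sum _ _ _
    _ ≤ ∑ j ∈ Finset.range m, ε * k := Finset.sum_le_sum hterm
    _ = (m * k : ℝ≥0) * ε := by
        rw [Finset.sum_const, Finset.card_range, nsmul_eq_mul]; push_cast; ring

end

end OperatorFamily

/-! ### Density and Cauchy criteria -/

theorem NNReal.denseRange_nnratCast : DenseRange ((↑) : ℚ≥0 → ℝ≥0) :=
  dense_of_exists_between fun _ _ h => by
    obtain ⟨c, hc, hac, hcb⟩ := (NNReal.lt_iff_exists_rat_btwn _ _).1 h
    refine ⟨_, ⟨⟨c, hc⟩, ?_⟩, hac, hcb⟩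
    rw [← NNReal.coe_inj, Real.coe_toNNReal _ (by exact_mod_cast hc)]
    rfl

theorem cauchySeq_of_seminorm {𝕜 X : Type*} [RCLike 𝕜] [AddCommGroup X] [Module 𝕜 X]
    [UniformSpace X] [IsUniformAddGroup X] [PolynormableSpace 𝕜 X] {u : ℕ → X}
    (hu : ∀ q : Seminorm 𝕜 X, Continuous q → ∀ ε : ℝ, 0 < ε →
      ∃ N, ∀ m ≥ N, ∀ n ≥ N, q (u n - u m) < ε) : CauchySeq u := by
  rw [cauchySeq_iff_tendsto, uniformity_eq_comap_nhds_zero, tendsto_comap_iff,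
    (PolynormableSpace.withSeminorms 𝕜 X).tendsto_nhds]
  intro q ε hε
  obtain ⟨N, hN⟩ := hu q.1 q.2 ε hε
  filter_upwards [eventually_ge_atTop (N, N)] with a ha
  simpa using hN _ ha.1 _ ha.2

/-! ### Generator values along orbits -/

namespace OperatorFamily

section

variable {𝕜 X : Type*} [RCLike 𝕜] [AddCommGroup X] [Module 𝕜 X]

theorem HasGeneratorValue.map [TopologicalSpace X] {T : ℝ≥0 → X →L[𝕜] X} (hT : IsSemigroup T)
    {x y : X} (h : HasGeneratorValue T x y) (s : ℝ≥0) : HasGeneratorValue T (T s x) (T s y) := by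
  refine (((T s).continuous.tendsto y).comp h).congr fun t => ?_
  simp only [Function.comp_apply, map_smul, map_sub]
  rw [← hT.map_add_apply, ← hT.map_add_apply, add_comm]

theorem hasGeneratorValue_generator [TopologicalSpace X] [IsTopologicalAddGroup X]
    [ContinuousSMul 𝕜 X] [T2Space X] {T : ℝ≥0 → X →L[𝕜] X} (x : (generator T).domain) :
    HasGeneratorValue T (x : X) (generator T x) :=
  x.2.choose_spec

variable [UniformSpace X] [IsUniformAddGroup X] {T : ℝ≥0 → X →L[𝕜] X}

theorem exists_tendsto_orbitQuotient [PolynormableSpace 𝕜 X] (hX : IsSequentiallyComplete X)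
    (hT : IsSemigroup T) (hcont : IsStronglyContinuous T) (hequi : IsLocallyEquicontinuous T)
    {r : ℝ≥0} (hbdd : HasBoundedSemivariation T 0 r) (x : X) {t : ℝ≥0} (ht : 0 < t) (htr : t < r) :
    ∃ L, Tendsto (fun n : ℕ => orbitQuotient T x t ((n : ℝ≥0) + 1)⁻¹) atTop (𝓝 L) := by
  refine hX _ (cauchySeq_of_seminorm (𝕜 := 𝕜) fun q hq ε hε => ?_)
  have ht' : (0 : ℝ) < t := ht
  obtain ⟨δ, hδ, H⟩ := exists_orbitQuotient_sub_le hT hcont hequi hbdd hq x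
    (ε := t * (ε / 3)) (by positivity)
  have hlim : Tendsto (fun n : ℕ => ((n : ℝ≥0) + 1)⁻¹) atTop (𝓝 0) := by
    simpa using tendsto_one_div_add_atTop_nhds_zero_nat (𝕜 := ℝ≥0)
  obtain ⟨N, hN⟩ := eventually_atTop.1 (hlim.eventually_lt_const (lt_min ht hδ))
  -- The step `1 / ((m + 1) * (n + 1))` is a common refinement of `1 / (m + 1)` and `1 / (n + 1)`.
  have key : ∀ m ≥ N, ∀ n : ℕ, q (orbitQuotient T x t ((m : ℝ≥0) + 1)⁻¹ -
      orbitQuotient T x t ((m + 1 : ℝ≥0) * (n + 1))⁻¹) ≤ ε / 3 := by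
    intro m hm n
    have hmul : ((n + 1 : ℕ) : ℝ≥0) * ((m + 1 : ℝ≥0) * (n + 1))⁻¹ = (m + 1 : ℝ≥0)⁻¹ := by
      have : (n + 1 : ℝ≥0) ≠ 0 := by positivity
      push_cast
      field_simp
    have := H t ((m + 1 : ℝ≥0) * (n + 1))⁻¹ (n + 1) htr (by positivity) n.succ_pos
      (by rw [hmul]; exact ((hN m hm).trans_le (min_le_left _ _)).le)
      (by rw [hmul]; exact (hN m hm).trans_le (min_le_right _ _))
    rw [hmul] at this
    exact le_of_mul_le_mul_left this ht'
  refine ⟨N, fun m hm n hn => ?_⟩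
  have h1 := key m hm n
  have h2 := key n hn m
  rw [mul_comm, map_sub_rev] at h1
  have h4 := map_sub_le_add q (orbitQuotient T x t ((n : ℝ≥0) + 1)⁻¹ -
      orbitQuotient T x t ((n + 1 : ℝ≥0) * (m + 1))⁻¹) (orbitQuotient T x t ((m : ℝ≥0) + 1)⁻¹ -
      orbitQuotient T x t ((n + 1 : ℝ≥0) * (m + 1))⁻¹)
  rw [sub_sub_sub_cancel_right] at h4
  rw [map_sub_rev] at h1
  linarith

/-- Steps are comparable only when one is an integer multiple of the other. A rational `a / b` is a
multiple of each `1 / (b * (n + 1))`, which settles rational steps; real ones follow by continuity.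
-/
theorem exists_orbitQuotient_sub_limit_le [ContinuousSMul 𝕜 X] (hT : IsSemigroup T)
    (hcont : IsStronglyContinuous T) (hequi : IsLocallyEquicontinuous T) {r : ℝ≥0}
    (hbdd : HasBoundedSemivariation T 0 r) {q : Seminorm 𝕜 X} (hq : Continuous q) (x : X)
    {ε : ℝ} (hε : 0 < ε) :
    ∃ δ : ℝ≥0, 0 < δ ∧ ∀ (t : ℝ≥0) (L : X), t < r →
      Tendsto (fun n : ℕ => orbitQuotient T x t ((n : ℝ≥0) + 1)⁻¹) atTop (𝓝 L) →
      ∀ h, 0 < h → h < t → h < δ → t * q (orbitQuotient T x t h - L) ≤ ε := by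
  obtain ⟨δ, hδ, H⟩ := exists_orbitQuotient_sub_le hT hcont hequi hbdd hq x hε
  refine ⟨δ, hδ, fun t L htr hL => ?_⟩
  have hrat : ∀ a b : ℕ, 0 < a → 0 < b → (a / b : ℝ≥0) < t → (a / b : ℝ≥0) < δ →
      t * q (orbitQuotient T x t (a / b) - L) ≤ ε := by
    intro a b ha hb hat haδ
    have hb' : (b : ℝ≥0) ≠ 0 := by exact_mod_cast hb.ne'
    -- The shift by one selects exactly the steps `1 / (b * (n + 1))` from the sequence `1 / (n +
    -- 1)`.
    have hsub : Tendsto (fun n : ℕ => b * (n + 1) - 1) atTop atTop :=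
      tendsto_atTop_mono (fun n => by
        have : n + 1 ≤ b * (n + 1) := Nat.le_mul_of_pos_left _ hb
        exact Nat.le_sub_one_of_lt this) tendsto_id
    have hlim : Tendsto (fun n : ℕ => t * q (orbitQuotient T x t (a / b) -
        orbitQuotient T x t (((b * (n + 1) - 1 : ℕ) : ℝ≥0) + 1)⁻¹)) atTop
        (𝓝 (t * q (orbitQuotient T x t (a / b) - L))) :=
      ((hq.tendsto _).comp (tendsto_const_nhds.sub (hL.comp hsub))).const_mul _
    refine le_of_tendsto' hlim fun n => ?_
    have hcast : (((b * (n + 1) - 1 : ℕ) : ℝ≥0) + 1) = b * (n + 1) := by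
      have : 1 ≤ b * (n + 1) := Nat.mul_pos hb n.succ_pos
      rw [← Nat.cast_add_one, Nat.sub_add_cancel this]
      push_cast; ring
    have hmul : ((a * (n + 1) : ℕ) : ℝ≥0) * (b * (n + 1) : ℝ≥0)⁻¹ = a / b := by
      have : (n + 1 : ℝ≥0) ≠ 0 := by positivity
      push_cast
      field_simp
    have := H t (b * (n + 1) : ℝ≥0)⁻¹ (a * (n + 1)) htr (by positivity)
      (Nat.mul_pos ha n.succ_pos) (by rw [hmul]; exact hat.le) (by rw [hmul]; exact haδ)
    rwa [hmul, ← hcast] at this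
  have hquot : ∀ h : ℝ≥0, 0 < h → (t * q (orbitQuotient T x t h - L) ≤ ε ↔
      t * q (T (t + h) x - T t x - ((h : ℝ) : 𝕜) • L) ≤ ε * h) := by
    intro h hh
    have hh' : (0 : ℝ) < h := hh
    have h0 : ((h : ℝ) : 𝕜) ≠ 0 := by exact_mod_cast hh'.ne'
    have : orbitQuotient T x t h - L =
        (((h : ℝ) : 𝕜))⁻¹ • (T (t + h) x - T t x - ((h : ℝ) : 𝕜) • L) := by
      rw [smul_sub, smul_smul, inv_mul_cancel₀ h0, one_smul, orbitQuotient]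
    rw [this, q.map_nnreal_inv_smul, mul_left_comm, inv_mul_le_iff₀ hh', mul_comm ε]
  intro h hh hht hhδ
  rw [hquot h hh]
  -- A strict violation is an open condition on the step, so it would also occur at a rational step.
  by_contra! hlt
  have hcts : Continuous fun h : ℝ≥0 => t * q (T (t + h) x - T t x - ((h : ℝ) : 𝕜) • L) := by
    refine continuous_const.mul (hq.comp ((((hcont x).comp (continuous_const.add
      continuous_id)).sub continuous_const).sub (Continuous.smul ?_ continuous_const)))
    exact RCLike.continuous_ofReal.comp NNReal.continuous_coe
  have hev : ∀ᶠ h' : ℝ≥0 in 𝓝 h, (0 < h' ∧ h' < t ∧ h' < δ) ∧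
      ε * h' < t * q (T (t + h') x - T t x - ((h' : ℝ) : 𝕜) • L) :=
    (((eventually_gt_nhds hh).and ((eventually_lt_nhds hht).and (eventually_lt_nhds hhδ)))).and
      ((continuous_const.mul NNReal.continuous_coe).continuousAt.eventually_lt
        hcts.continuousAt hlt)
  obtain ⟨_, ⟨c, rfl⟩, ⟨hw0, hwt, hwδ⟩, hw⟩ :=
    NNReal.denseRange_nnratCast.inter_nhds_nonempty hev
  refine hw.not_ge ?_
  rw [← hquot _ hw0]
  rw [NNRat.cast_def] at hw0 hwt hwδ ⊢
  refine hrat _ _ ?_ c.den_pos hwt hwδ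
  by_contra! h0
  simp [Nat.le_zero.1 h0] at hw0

theorem exists_generatorValue_orbit [ContinuousSMul 𝕜 X] [PolynormableSpace 𝕜 X]
    (hX : IsSequentiallyComplete X)
    (hT : IsSemigroup T) (hcont : IsStronglyContinuous T) (hequi : IsLocallyEquicontinuous T)
    {r : ℝ≥0} (hbdd : HasBoundedSemivariation T 0 r) (x : X) {t : ℝ≥0} (ht : 0 < t) (htr : t < r) :
    ∃ L, HasGeneratorValue T (T t x) L ∧
      Tendsto (fun n : ℕ => orbitQuotient T x t ((n : ℝ≥0) + 1)⁻¹) atTop (𝓝 L) := by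
  obtain ⟨L, hL⟩ := exists_tendsto_orbitQuotient hX hT hcont hequi hbdd x ht htr
  refine ⟨L, ?_, hL⟩
  rw [HasGeneratorValue, (PolynormableSpace.withSeminorms 𝕜 X).tendsto_nhds]
  intro q ε hε
  have ht' : (0 : ℝ) < t := ht
  obtain ⟨δ, hδ, H⟩ := exists_orbitQuotient_sub_limit_le hT hcont hequi hbdd q.2 x
    (ε := t * (ε / 2)) (by positivity)
  filter_upwards [Ioo_mem_nhdsGT (lt_min ht hδ)] with h hh
  have := le_of_mul_le_mul_left (H t L htr hL h hh.1 (hh.2.trans_le (min_le_left _ _))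
    (hh.2.trans_le (min_le_right _ _))) ht'
  rw [orbitQuotient, add_comm, hT.map_add_apply] at this
  exact this.trans_lt (half_lt_self hε)

/-- The generator commutes with the semigroup, so a single time `t₀ < min t r` determines the values
at all later times; the explicit form is continuous in `s`. -/
theorem exists_generatorValue_orbit_of_pos [ContinuousSMul 𝕜 X] [PolynormableSpace 𝕜 X]
    (hX : IsSequentiallyComplete X)
    (hT : IsSemigroup T) (hcont : IsStronglyContinuous T) (hequi : IsLocallyEquicontinuous T)
    {r : ℝ≥0} (hr : 0 < r) (hbdd : HasBoundedSemivariation T 0 r) (x : X) {t : ℝ≥0} (ht : 0 < t) :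
    ∃ t₀ < t, ∃ L, ∀ s, t₀ ≤ s → HasGeneratorValue T (T s x) (T (s - t₀) L) := by
  have hm : 0 < min t r := lt_min ht hr
  have hlt : min t r / 2 < min t r := NNReal.half_lt_self hm.ne'
  obtain ⟨L, hL, -⟩ := exists_generatorValue_orbit hX hT hcont hequi hbdd x
    (half_pos hm) (hlt.trans_le (min_le_right _ _))
  refine ⟨_, hlt.trans_le (min_le_left _ _), L, fun s hs => ?_⟩
  have := hL.map hT (s - min t r / 2)
  rwa [← hT.map_add_apply, tsub_add_cancel_of_le hs] at this

/-- Compare `t • L`, where `L` is the generator value at `T t x`, with `t` times the quotient of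
step `t / 2`. The error is uniformly small in `t`, and the comparison term is twice an orbit
increment, which tends to `0` by strong continuity. -/
theorem tendsto_smul_generatorValue_zero [ContinuousSMul 𝕜 X] [PolynormableSpace 𝕜 X] [T2Space X]
    (hX : IsSequentiallyComplete X)
    (hT : IsSemigroup T) (hcont : IsStronglyContinuous T) (hequi : IsLocallyEquicontinuous T)
    {r : ℝ≥0} (hr : 0 < r) (hbdd : HasBoundedSemivariation T 0 r) (x : X) {F : ℝ≥0 → X}
    (hF : ∀ t : ℝ≥0, HasGeneratorValue T (((t : ℝ) : 𝕜) • T t x) (F t)) : Tendsto F (𝓝 0) (𝓝 0) := by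
  rw [(PolynormableSpace.withSeminorms 𝕜 X).tendsto_nhds]
  intro q ε hε
  obtain ⟨δ, hδ, H⟩ := exists_orbitQuotient_sub_limit_le hT hcont hequi hbdd q.2 x
    (ε := ε / 2) (by positivity)
  have hlim : Tendsto (fun t : ℝ≥0 => 2 * q.1 (T (t + t / 2) x - T t x)) (𝓝 0) (𝓝 0) := by
    have : Continuous fun t : ℝ≥0 => 2 * q.1 (T (t + t / 2) x - T t x) :=
      continuous_const.mul (q.2.comp (((hcont x).comp
        (continuous_id.add (continuous_id.div_const 2))).sub (hcont x)))
    simpa using this.tendsto 0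
  filter_upwards [hlim.eventually_lt_const (half_pos hε), eventually_lt_nhds hδ,
    eventually_lt_nhds hr] with t h1 htδ htr
  rw [sub_zero]
  rcases eq_zero_or_pos t with rfl | ht
  · have : F 0 = 0 := (hF 0).unique (by simpa using HasGeneratorValue.zero T)
    simpa [this] using hε
  obtain ⟨L, hL, hL'⟩ := exists_generatorValue_orbit hX hT hcont hequi hbdd x ht htr
  have ht' : (0 : ℝ) < t := ht
  have hhalf : t / 2 < t := NNReal.half_lt_self ht.ne'
  have h2 := H t L htr hL' (t / 2) (half_pos ht) hhalf (hhalf.trans htδ)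
  have h3 : t * q.1 (orbitQuotient T x t (t / 2)) = 2 * q.1 (T (t + t / 2) x - T t x) := by
    rw [orbitQuotient, q.1.map_nnreal_inv_smul]
    push_cast
    field_simp
  have h4 : q.1 (F t) = t * q.1 L := by
    rw [(hF t).unique (hL.smul _), map_smul_eq_mul, RCLike.norm_ofReal, abs_of_pos ht']
  have h5 : q.1 L ≤ q.1 (orbitQuotient T x t (t / 2)) +
      q.1 (orbitQuotient T x t (t / 2) - L) := by
    simpa using map_sub_le_add q.1 (orbitQuotient T x t (t / 2))
      (orbitQuotient T x t (t / 2) - L)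
  rw [h4]
  nlinarith [mul_le_mul_of_nonneg_left h5 ht'.le]

end

end OperatorFamily

/-! ### Smoothing and continuity up to zero -/

theorem mainTheorem10 {𝕜 X : Type*} [RCLike 𝕜] [AddCommGroup X] [Module 𝕜 X]
    [UniformSpace X] [IsUniformAddGroup X] [ContinuousSMul 𝕜 X] [PolynormableSpace 𝕜 X]
    [T2Space X] (hX : IsSequentiallyComplete X)
    (T : ℝ≥0 → X →L[𝕜] X)
    (hsemi : OperatorFamily.IsSemigroup T)
    (hcont : OperatorFamily.IsStronglyContinuous T)
    (hequi : OperatorFamily.IsLocallyEquicontinuous T)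
    (r : ℝ≥0) (hr : 0 < r)
    (hbdd : HasBoundedSemivariation T 0 r) :
    (∀ t : ℝ≥0, 0 < t → ∀ x : X, T t x ∈ (OperatorFamily.generator T).domain) ∧
      ∀ x : X, ∃ hmem : ∀ t : ℝ≥0,
          ((t : ℝ) : 𝕜) • T t x ∈ (OperatorFamily.generator T).domain,
        Continuous fun t : ℝ≥0 =>
          OperatorFamily.generator T ⟨((t : ℝ) : 𝕜) • T t x, hmem t⟩ := by
  have hpos : ∀ t : ℝ≥0, 0 < t → ∀ x : X, T t x ∈ (OperatorFamily.generator T).domain := by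
    intro t ht x
    obtain ⟨t₀, ht₀, L, hL⟩ :=
      OperatorFamily.exists_generatorValue_orbit_of_pos hX hsemi hcont hequi hr hbdd x ht
    exact ⟨_, hL t ht₀.le⟩
  refine ⟨hpos, fun x => ?_⟩
  have hmem : ∀ t : ℝ≥0, ((t : ℝ) : 𝕜) • T t x ∈ (OperatorFamily.generator T).domain := by
    intro t
    rcases eq_zero_or_pos t with rfl | ht
    · simp
    · exact Submodule.smul_mem _ _ (hpos t ht x)
  have hval : ∀ t : ℝ≥0, OperatorFamily.HasGeneratorValue T (((t : ℝ) : 𝕜) • T t x)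
      (OperatorFamily.generator T ⟨((t : ℝ) : 𝕜) • T t x, hmem t⟩) :=
    fun t => OperatorFamily.hasGeneratorValue_generator ⟨_, hmem t⟩
  refine ⟨hmem, continuous_iff_continuousAt.2 fun t => ?_⟩
  rcases eq_zero_or_pos t with rfl | ht
  · have h0 : OperatorFamily.generator T ⟨(((0 : ℝ≥0) : ℝ) : 𝕜) • T 0 x, hmem 0⟩ = 0 :=
      (hval 0).unique (by simpa using OperatorFamily.HasGeneratorValue.zero T)
    rw [ContinuousAt, h0]
    exact OperatorFamily.tendsto_smul_generatorValue_zero hX hsemi hcont hequi hr hbdd x hval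
  · obtain ⟨t₀, ht₀, L, hL⟩ :=
      OperatorFamily.exists_generatorValue_orbit_of_pos hX hsemi hcont hequi hr hbdd x ht
    -- Near `t > t₀` the map agrees with this continuous one, by uniqueness of generator values;
    -- truncated subtraction is harmless there.
    have hcts : Continuous fun s : ℝ≥0 => ((s : ℝ) : 𝕜) • T (s - t₀) L :=
      (RCLike.continuous_ofReal.comp NNReal.continuous_coe).smul
        ((hcont L).comp (continuous_id.sub continuous_const))
    refine hcts.continuousAt.congr ?_
    filter_upwards [eventually_gt_nhds ht₀] with s hs
    exact ((hL s hs.le).smul _).unique (hval s)
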